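/- Let $d\ge 1$ be an integer, $\nu\ge 0$ and $\beta>0$. For a function $\phi:[0,\infty)\to\mathbb R$ with $\int_0^\infty |\phi(r)|\,r^{d-1}\,dr<\infty$, its isotropic spectral density in dimension $d$ is $$\widehat\phi(z)=\frac{z^{1-d/2}}{(2\pi)^{d/2}}\int_0^\infty u^{d/2}J_{d/2-1}(uz)\,\phi(u)\,du,\qquad z>0,$$ where $J_a$ is the Bessel function of the first kind. For $\mu>0$ put $$\delta_{\nu,\mu,\beta}=\beta\left(\frac{\Gamma(\mu+2\nu+1)}{\Gamma(\mu)}\right)^{1/(1+2\nu)},\qquad \varphi_{\nu,\mu,\beta}(r)=\mathcal{GW}_{\nu,\mu,\delta_{\nu,\mu,\beta}}(r),\quad r\ge 0,$$ where $\mathcal{GW}_{\nu,\mu,\delta}$ is the generalized Wendland function: $\mathcal{GW}_{\nu,\mu,\delta}(r)=0$ for $r>\delta$, and for $0\le r\le\delta$ $$\mathcal{GW}_{\nu,\mu,\delta}(r)=\frac{1}{B(2\nu,\mu+1)}\int_{r/\delta}^1 u\,\bigl(u^2-(r/\delta)^2\bigr)^{\nu-1}(1-u)^\mu\,du\quad(\nu>0),\qquad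 \mathcal{GW}_{0,\mu,\delta}(r)=(1-r/\delta)^\mu ,$$ with $B$ the Beta function. Let $$\mathcal M_{\nu+1/2,\beta}(r)=\frac{2^{1/2-\nu}}{\Gamma(\nu+1/2)}\left(\frac r\beta\right)^{\nu+1/2}\mathcal K_{\nu+1/2}\!\left(\frac r\beta\right)$$ (with value $1$ at $r=0$) be the Matérn correlation function, $\mathcal K_a$ being the modified Bessel function of the second kind. Write $\lambda=(d+1)/2+\nu$. Then: 1. For every $\mu>0$, $\varphi_{\nu,\mu,\beta}(r)\,r^{d-1}$ is integrable on $(0,\infty)$, and for every $z>0$, with $\delta=\delta_{\nu,\mu,\beta}$, $$\widehat\varphi_{\nu,\mu,\beta}(z)=\frac{2^{-d}\pi^{-d/2}\,\Gamma(\mu+2\nu+1)\,\Gamma(2\nu+d)\,\Gamma(\nu)\,\delta^d}{\Gamma(\nu+d/2)\,\Gamma(\mu+2\nu+d+1)\,\Gamma(2\nu)}\;{}_1F_2\!\left(\lambda;\lambda+\tfrac{\mu}{2},\lambda+\tfrac{\mu+1}{2};-\tfrac{(z\delta)^2}{4}\right),$$ where for $\nu=0$ the quotient $\Gamma(\nu)/\Gamma(2\nu)$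 is read as its limit $2$, and ${}_1F_2(a;b,c;x)=\sum_{k\ge0}\frac{(a)_k}{(b)_k(c)_k}\frac{x^k}{k!}$ with $(a)_k=a(a+1)\cdots(a+k-1)$. 2. $\mathcal M_{\nu+1/2,\beta}(r)\,r^{d-1}$ is integrable on $(0,\infty)$, and for every $z>0$ $$\widehat{\mathcal M}_{\nu+1/2,\beta}(z)=\frac{\Gamma\bigl(\nu+\frac{d+1}{2}\bigr)}{\pi^{d/2}\,\Gamma\bigl(\nu+\frac12\bigr)}\,\frac{\beta^d}{(1+\beta^2z^2)^{\nu+(d+1)/2}} .$$ 3. As $\mu\to\infty$ through the reals, $\widehat\varphi_{\nu,\mu,\beta}(z)\to\widehat{\mathcal M}_{\nu+1/2,\beta}(z)$, uniformly for $z$ in any bounded subinterval of $(0,\infty)$. -/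

import Mathlib

noncomputable section

namespace Wendland

open MeasureTheory

/-- Bessel function of the first kind of real order `a`, through its power series, at `x > 0`
(the poles of the Gamma function contribute `0`, since `Real.Gamma` vanishes there). -/
def besselJ (a x : ℝ) : ℝ :=
  ∑' k : ℕ, (-1) ^ k / ((k.factorial : ℝ) * Real.Gamma (k + a + 1)) * (x / 2) ^ (2 * (k : ℝ) + a)

/-- Modified Bessel function of the second kind of real order `a`, at `x > 0`. -/
def besselK (a x : ℝ) : ℝ :=
  ∫ t in Set.Ioi (0 : ℝ), Real.exp (-x * Real.cosh t) * Real.cosh (a * t)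

/-- The generalized hypergeometric function `₁F₂(a; b, c; x)`. -/
def hypergeometric1F2 (a b c x : ℝ) : ℝ :=
  ∑' k : ℕ, (ascPochhammer ℝ k).eval a /
    ((ascPochhammer ℝ k).eval b * (ascPochhammer ℝ k).eval c) * (x ^ k / (k.factorial : ℝ))

/-- The isotropic spectral density in dimension `d` of `φ : [0,∞) → ℝ`, at `z > 0`: the radial
profile of `ξ ↦ (2π)^{-d} ∫ exp(-i⟨x,ξ⟩) φ(‖x‖) dx` on `ℝ^d`, written as a Hankel transform. -/
def spectralDensity (d : ℕ) (φ : ℝ → ℝ) (z : ℝ) : ℝ :=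
  z ^ (1 - (d : ℝ) / 2) / (2 * Real.pi) ^ ((d : ℝ) / 2) *
    ∫ u in Set.Ioi (0 : ℝ), u ^ ((d : ℝ) / 2) * besselJ ((d : ℝ) / 2 - 1) (u * z) * φ u

/-- The Matérn correlation function `M_{ν,β}(r)`, for `r ≥ 0` (at `r = 0` by continuity). -/
def matern (ν β r : ℝ) : ℝ :=
  if r = 0 then 1
  else 2 ^ (1 - ν) / Real.Gamma ν * (r / β) ^ ν * besselK ν (r / β)

/-- The closed form of the Matérn spectral density in dimension `d`. -/
def maternDensity (d : ℕ) (ν β z : ℝ) : ℝ :=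
  Real.Gamma (ν + (d : ℝ) / 2) / (Real.pi ^ ((d : ℝ) / 2) * Real.Gamma ν) *
    (β ^ d / (1 + β ^ 2 * z ^ 2) ^ (ν + (d : ℝ) / 2))

/-- The generalized Wendland correlation function `GW_{ν,μ,β}(r)`, for `r ≥ 0`; for `ν = 0` it is
the Askey function. -/
def genWendland (ν μ β r : ℝ) : ℝ :=
  if r ≤ β then
    if ν = 0 then (1 - r / β) ^ μ
    else 1 / ProbabilityTheory.beta (2 * ν) (μ + 1) *
      ∫ u in (r / β)..1, u * (u ^ 2 - (r / β) ^ 2) ^ (ν - 1) * (1 - u) ^ μ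
  else 0

/-- `λ(d,ν) = (d+1)/2 + ν`. -/
def lam (d : ℕ) (ν : ℝ) : ℝ := ((d : ℝ) + 1) / 2 + ν

/-- `Γ(ν)/Γ(2ν)`, with its limit `2` at `ν = 0`. -/
def gammaRatio (ν : ℝ) : ℝ := if ν = 0 then 2 else Real.Gamma ν / Real.Gamma (2 * ν)

/-- The closed form of the generalized Wendland spectral density in dimension `d`. -/
def genWendlandDensity (d : ℕ) (ν μ β z : ℝ) : ℝ :=
  2 ^ (-(d : ℝ)) * Real.pi ^ (-(d : ℝ) / 2) * Real.Gamma (μ + 2 * ν + 1) *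
      Real.Gamma (2 * ν + d) * gammaRatio ν /
      (Real.Gamma (ν + (d : ℝ) / 2) * Real.Gamma (μ + 2 * ν + d + 1)) * β ^ d *
    hypergeometric1F2 (lam d ν) (lam d ν + μ / 2) (lam d ν + (μ + 1) / 2) (-(z * β) ^ 2 / 4)

/-- The compact support parameter `δ_{ν,μ,β}`. -/
def delta (ν μ β : ℝ) : ℝ :=
  β * (Real.Gamma (μ + 2 * ν + 1) / Real.Gamma μ) ^ (1 / (1 + 2 * ν))

/-- The reparametrized generalized Wendland correlation `φ_{ν,μ,β}`. -/
def phi (ν μ β r : ℝ) : ℝ := genWendland ν μ (delta ν μ β) r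

end Wendland

end

/-!
Fractional integration of order `ν` in the variable `r ^ 2` is adjoint to Sonine's integral, which
expresses the normalised Bessel kernel of order `a + ν` through the one of order `a`. Integrating a
radial function in this way therefore raises the order of its Hankel transform from `a` to `a + ν`.
The generalized Wendland function is, up to a constant, the fractional integral of the Askey
function `(1 - r / δ)₊ ^ μ`, whose Hankel transforms are `₁F₂` series; the transform of the Matérn
function, found from Weber's integral, is the Hankel transform of order `a + ν` of `exp (-r / β)`,
up to a constant. As `μ → ∞` one has `δ / μ → β`, so the Askey functions tend to `exp (-r / β)` in
weighted `L¹`. The normalised Bessel kernel being bounded, `L¹` convergence gives convergence of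
the Hankel transforms uniformly in `z`.
-/

noncomputable section

namespace Wendland

open MeasureTheory Set Filter Topology

section BetaIntegral

variable {a b s ν c w : ℝ}

theorem integral_rpow_mul_sub_rpow (ha : 0 < a) (hb : 0 < b) (hc : 0 < c) :
    ∫ x in Ioo 0 c, x ^ (a - 1) * (c - x) ^ (b - 1)
      = c ^ (a + b - 1) * ProbabilityTheory.beta a b := by
  have hcongr : EqOn (fun x : ℝ => (x : ℂ) ^ ((a : ℂ) - 1) * ((c : ℂ) - x) ^ ((b : ℂ) - 1))
      (fun x : ℝ => ((x ^ (a - 1) * (c - x) ^ (b - 1) : ℝ) : ℂ)) (Ioo 0 c) := fun x hx => by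
    push_cast [Complex.ofReal_cpow hx.1.le, Complex.ofReal_cpow (sub_nonneg.2 hx.2.le)]
    rfl
  have hpow : (c : ℂ) ^ ((a : ℂ) + b - 1) = ((c ^ (a + b - 1) : ℝ) : ℂ) := by
    push_cast [Complex.ofReal_cpow hc.le]
    rfl
  have hscaled := Complex.betaIntegral_scaled a b hc
  rw [intervalIntegral.integral_of_le hc.le, integral_Ioc_eq_integral_Ioo,
    setIntegral_congr_fun measurableSet_Ioo hcongr, integral_complex_ofReal, hpow] at hscaled
  rw [ProbabilityTheory.beta_eq_betaIntegralReal a b ha hb, ← Complex.re_ofReal_mul, ← hscaled,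
    Complex.ofReal_re]

theorem integral_rpow_mul_sq_sub_sq_rpow (hs : 0 < s) (hν : 0 < ν) (hw : 0 < w) :
    ∫ r in Ioo 0 w, r ^ (s - 1) * (w ^ 2 - r ^ 2) ^ (ν - 1)
      = w ^ (s + 2 * ν - 2) * (ProbabilityTheory.beta (s / 2) ν / 2) := by
  have hbeta := integral_rpow_mul_sub_rpow (half_pos hs) hν (pow_pos hw 2)
  rw [← Ioi_inter_Iio, ← setIntegral_indicator measurableSet_Iio,
    ← integral_comp_rpow_Ioi_of_pos two_pos] at hbeta
  rw [← Ioi_inter_Iio, ← setIntegral_indicator measurableSet_Iio]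
  have hsubst : ∀ r ∈ Ioi (0 : ℝ),
      (Iio w).indicator (fun r => r ^ (s - 1) * (w ^ 2 - r ^ 2) ^ (ν - 1)) r
        = 1 / 2 * ((2 * r ^ ((2 : ℝ) - 1)) • (Iio (w ^ 2)).indicator
          (fun x => x ^ (s / 2 - 1) * (w ^ 2 - x) ^ (ν - 1)) (r ^ (2 : ℝ))) := by
    intro r hr
    have hpow : r ^ (s - 1) = r * (r ^ 2) ^ (s / 2 - 1) := by
      rw [← Real.rpow_natCast_mul (le_of_lt hr), mul_comm, ← Real.rpow_add_one (ne_of_gt hr)]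
      congr 1
      push_cast
      ring
    have hlt : r ^ 2 < w ^ 2 ↔ r < w := pow_lt_pow_iff_left₀ (le_of_lt hr) hw.le two_ne_zero
    norm_num only [Real.rpow_two, Real.rpow_one, indicator_apply, mem_Iio, hlt, hpow, smul_eq_mul]
    split_ifs <;> ring
  rw [setIntegral_congr_fun measurableSet_Ioi hsubst, integral_const_mul, hbeta,
    ← Real.rpow_natCast_mul hw.le]
  norm_num only
  ring_nf

end BetaIntegral

section Bessel

variable {a x : ℝ}

/-- The `k`-th coefficient, up to sign, of the power series of `(x / 2) ^ (-a) * J_a(x)` in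
`(x / 2) ^ 2`. -/
def besselCoeff (a : ℝ) (k : ℕ) : ℝ := 1 / (k.factorial * Real.Gamma (k + a + 1))

/-- The entire function `(x / 2) ^ (-a) * J_a(x)`, which removes the singularity of the Bessel
function `J_a` at the origin and is the kernel of the Hankel transform. -/
def besselEntire (a x : ℝ) : ℝ := ∑' k : ℕ, (-1) ^ k * besselCoeff a k * (x / 2) ^ (2 * k)

theorem besselCoeff_pos (ha : -1 < a) (k : ℕ) : 0 < besselCoeff a k := by
  have hΓ : 0 < Real.Gamma (k + a + 1) := Real.Gamma_pos_of_pos (by linarith)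
  unfold besselCoeff
  positivity

theorem summable_besselCoeff (ha : -1 < a) (x : ℝ) :
    Summable fun k : ℕ => besselCoeff a k * (x / 2) ^ (2 * k) := by
  obtain ⟨y, hy, hmin⟩ := Real.exists_isMinOn_Gamma_Ioi
  have hy : 0 < Real.Gamma y := Real.Gamma_pos_of_pos (by linarith [hy.1])
  refine Summable.of_nonneg_of_le (fun k => ?_) (fun k => ?_)
    ((Real.summable_pow_div_factorial ((x / 2) ^ 2)).mul_left (1 / Real.Gamma y))
  · have := besselCoeff_pos ha k
    rw [pow_mul]
    positivity
  · have hk : (0 : ℝ) < k + a + 1 := by linarith [k.cast_nonneg (α := ℝ)]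
    calc besselCoeff a k * (x / 2) ^ (2 * k)
        ≤ 1 / (k.factorial * Real.Gamma y) * (x / 2) ^ (2 * k) := by
          have hle : Real.Gamma y ≤ Real.Gamma (k + a + 1) := hmin hk
          unfold besselCoeff
          gcongr
          rw [pow_mul]
          positivity
      _ = 1 / Real.Gamma y * (((x / 2) ^ 2) ^ k / k.factorial) := by
          rw [pow_mul]
          field_simp

theorem hasSum_besselEntire (ha : -1 < a) (x : ℝ) :
    HasSum (fun k : ℕ => (-1) ^ k * besselCoeff a k * (x / 2) ^ (2 * k)) (besselEntire a x) := by
  refine (Summable.of_norm ((summable_besselCoeff ha x).congr fun k => ?_)).hasSum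
  rw [norm_mul, norm_mul, norm_pow, norm_neg, norm_one, one_pow, one_mul, pow_mul,
    Real.norm_of_nonneg (besselCoeff_pos ha k).le, Real.norm_of_nonneg (by positivity)]

theorem measurable_besselEntire (ha : -1 < a) : Measurable (besselEntire a) :=
  measurable_of_tendsto_metrizable
    (f := fun n x => ∑ k ∈ Finset.range n, (-1) ^ k * besselCoeff a k * (x / 2) ^ (2 * k))
    (fun n => by fun_prop)
    (tendsto_pi_nhds.2 fun x => (hasSum_besselEntire ha x).tendsto_sum_nat)

theorem besselJ_eq_rpow_mul_besselEntire (a : ℝ) (hx : 0 < x) :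
    besselJ a x = (x / 2) ^ a * besselEntire a x := by
  rw [besselJ, besselEntire, ← tsum_mul_left]
  refine tsum_congr fun k => ?_
  rw [Real.rpow_add (by positivity), ← Real.rpow_natCast (x / 2) (2 * k), besselCoeff]
  push_cast
  ring

theorem besselEntire_zero (ha : -1 < a) : besselEntire a 0 = 1 / Real.Gamma (a + 1) := by
  have hterm : ∀ k : ℕ, k ≠ 0 → (-1) ^ k * besselCoeff a k * (0 / 2) ^ (2 * k) = 0 :=
    fun k hk => by simp [hk]
  simpa [besselCoeff] using (hasSum_besselEntire ha 0).unique (hasSum_single 0 hterm)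

theorem besselEntire_neg_half (x : ℝ) : besselEntire (-(1 / 2)) x = Real.cos x / √Real.pi := by
  refine (hasSum_besselEntire (by norm_num) x).unique
    (((Real.hasSum_cos x).div_const (√Real.pi)).congr_fun fun k => ?_)
  have hdup := Real.Gamma_mul_Gamma_add_half (k + 1 / 2)
  have hΓ : 0 < Real.Gamma (k + 1 / 2) := Real.Gamma_pos_of_pos (by positivity)
  rw [show (k : ℝ) + 1 / 2 + 1 / 2 = k + 1 by ring, Real.Gamma_nat_eq_factorial,
    show 2 * ((k : ℝ) + 1 / 2) = (2 * k : ℕ) + 1 by push_cast; ring, Real.Gamma_nat_eq_factorial,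
    show (1 : ℝ) - ((2 * k : ℕ) + 1) = -(2 * k : ℕ) by ring, Real.rpow_neg two_pos.le,
    Real.rpow_natCast] at hdup
  rw [besselCoeff, show (k : ℝ) + -(1 / 2) + 1 = k + 1 / 2 by ring, mul_comm (k.factorial : ℝ),
    hdup, div_pow]
  field_simp

end Bessel

section HankelTransform

variable {a b z w R : ℝ} {d : ℕ} {f g : ℝ → ℝ}

/-- The Hankel transform of order `a` with kernel `(x / 2) ^ (-a) * J_a(x)`. For `a = d / 2 - 1` it
is, up to a constant, the Fourier transform of a radial function on `ℝ^d`. -/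
def hankel (a : ℝ) (f : ℝ → ℝ) (z : ℝ) : ℝ :=
  ∫ u in Ioi 0, besselEntire a (u * z) * (u ^ (2 * a + 1) * f u)

theorem spectralDensity_eq_hankel (d : ℕ) (f : ℝ → ℝ) (hz : 0 < z) :
    spectralDensity d f z
      = 2 ^ (1 - (d : ℝ) / 2) / (2 * Real.pi) ^ ((d : ℝ) / 2) * hankel (d / 2 - 1) f z := by
  rw [spectralDensity, hankel, ← integral_const_mul, ← integral_const_mul]
  refine setIntegral_congr_fun measurableSet_Ioi fun u hu => ?_
  have hu : 0 < u := hu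
  have hupow : u ^ (2 * ((d : ℝ) / 2 - 1) + 1) = u ^ ((d : ℝ) / 2) * u ^ ((d : ℝ) / 2 - 1) := by
    rw [← Real.rpow_add hu]
    ring_nf
  have hzpow : z ^ (1 - (d : ℝ) / 2) * z ^ ((d : ℝ) / 2 - 1) = 1 := by
    rw [← Real.rpow_add hz]
    simp
  have htwo : (2 : ℝ) ^ (1 - (d : ℝ) / 2) = ((2 : ℝ) ^ ((d : ℝ) / 2 - 1))⁻¹ := by
    rw [← Real.rpow_neg zero_le_two]
    ring_nf
  simp only [besselJ_eq_rpow_mul_besselEntire _ (mul_pos hu hz),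
    Real.div_rpow (mul_pos hu hz).le zero_le_two, Real.mul_rpow hu.le hz.le, hupow, htwo]
  linear_combination (u ^ ((d : ℝ) / 2) * u ^ ((d : ℝ) / 2 - 1) *
    besselEntire ((d : ℝ) / 2 - 1) (u * z) * f u * ((2 : ℝ) ^ ((d : ℝ) / 2 - 1))⁻¹ /
    (2 * Real.pi) ^ ((d : ℝ) / 2)) * hzpow

theorem integrableOn_mul_pow_iff_rpow (hd : 1 ≤ d) :
    IntegrableOn (fun r => f r * r ^ (d - 1)) (Ioi 0) ↔
      IntegrableOn (fun r => r ^ (2 * ((d : ℝ) / 2 - 1) + 1) * f r) (Ioi 0) := by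
  refine integrableOn_congr_fun (fun r _ => ?_) measurableSet_Ioi
  have hexp : 2 * ((d : ℝ) / 2 - 1) + 1 = (d - 1 : ℕ) := by
    push_cast [hd]
    ring
  rw [hexp, Real.rpow_natCast, mul_comm]

theorem pow_two_mul_mul_rpow (a : ℝ) {u : ℝ} (hu : 0 < u) (k : ℕ) :
    u ^ (2 * k) * u ^ (2 * a + 1) = u ^ (2 * (a + k) + 1) := by
  rw [← Real.rpow_natCast, ← Real.rpow_add hu]
  push_cast
  ring_nf

theorem hasSum_hankel (ha : -1 < a) (z : ℝ)
    (hint : ∀ k : ℕ, IntegrableOn (fun u => u ^ (2 * (a + k) + 1) * f u) (Ioi 0))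
    (hsum : Summable fun k : ℕ => besselCoeff a k * (z / 2) ^ (2 * k) *
      ∫ u in Ioi 0, |u ^ (2 * (a + k) + 1) * f u|) :
    HasSum (fun k : ℕ => (-1) ^ k * besselCoeff a k * (z / 2) ^ (2 * k) *
      ∫ u in Ioi 0, u ^ (2 * (a + k) + 1) * f u) (hankel a f z) := by
  have hnorm : ∀ k : ℕ, ∫ u in Ioi 0, ‖(-1) ^ k * besselCoeff a k * (z / 2) ^ (2 * k) *
      (u ^ (2 * (a + k) + 1) * f u)‖ = besselCoeff a k * (z / 2) ^ (2 * k) *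
        ∫ u in Ioi 0, |u ^ (2 * (a + k) + 1) * f u| := fun k => by
    rw [← integral_const_mul]
    congr with u
    rw [norm_mul, norm_mul, norm_mul, norm_pow, norm_neg, norm_one, one_pow, one_mul, pow_mul,
      Real.norm_of_nonneg (besselCoeff_pos ha k).le, Real.norm_of_nonneg (by positivity),
      Real.norm_eq_abs]
  have h := hasSum_integral_of_summable_integral_norm
    (fun k : ℕ => (hint k).const_mul ((-1) ^ k * besselCoeff a k * (z / 2) ^ (2 * k)))
    (hsum.congr fun k => (hnorm k).symm)
  simp only [integral_const_mul] at h
  rwa [hankel, setIntegral_congr_fun measurableSet_Ioi fun u hu => ?_]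
  simp only [besselEntire, ← tsum_mul_right, ← pow_two_mul_mul_rpow a hu]
  refine tsum_congr fun k => ?_
  rw [mul_div_assoc, mul_pow]
  ring

theorem hasSum_hankel_of_eq_zero (ha : -1 < a) (z : ℝ)
    (hf : IntegrableOn (fun u => u ^ (2 * a + 1) * f u) (Ioi 0)) (hR : ∀ u, R < u → f u = 0) :
    HasSum (fun k : ℕ => (-1) ^ k * besselCoeff a k * (z / 2) ^ (2 * k) *
      ∫ u in Ioi 0, u ^ (2 * (a + k) + 1) * f u) (hankel a f z) := by
  have hbound : ∀ k : ℕ, ∀ u ∈ Ioi (0 : ℝ),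
      |u ^ (2 * (a + k) + 1) * f u| ≤ R ^ (2 * k) * |u ^ (2 * a + 1) * f u| := fun k u hu => by
    have hu : 0 < u := hu
    rw [← pow_two_mul_mul_rpow a hu, mul_assoc, abs_mul, abs_pow, abs_of_pos hu]
    rcases le_or_gt u R with h | h
    · gcongr
    · simp [hR u h]
  have hint : ∀ k : ℕ, IntegrableOn (fun u => u ^ (2 * (a + k) + 1) * f u) (Ioi 0) := fun k => by
    refine (hf.norm.const_mul (R ^ (2 * k))).mono' ?_
      (ae_restrict_of_forall_mem measurableSet_Ioi (hbound k))
    refine (((by fun_prop : Measurable fun u : ℝ => u ^ (2 * k)).aestronglyMeasurable.mul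
      hf.aestronglyMeasurable).congr ?_)
    refine ae_restrict_of_forall_mem measurableSet_Ioi fun u hu => ?_
    simp only [Pi.mul_apply, ← mul_assoc, pow_two_mul_mul_rpow a hu]
  refine hasSum_hankel ha z hint (Summable.of_nonneg_of_le (fun k => ?_) (fun k => ?_)
    ((summable_besselCoeff ha (R * z)).mul_right (∫ u in Ioi 0, |u ^ (2 * a + 1) * f u|)))
  all_goals have hk := besselCoeff_pos ha k
  · rw [pow_mul]
    exact mul_nonneg (by positivity) (integral_nonneg fun u => abs_nonneg _)
  · calc besselCoeff a k * (z / 2) ^ (2 * k) * ∫ u in Ioi 0, |u ^ (2 * (a + k) + 1) * f u|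
        ≤ besselCoeff a k * (z / 2) ^ (2 * k) *
          ∫ u in Ioi 0, R ^ (2 * k) * |u ^ (2 * a + 1) * f u| := by
          have hz : 0 ≤ (z / 2) ^ (2 * k) := by rw [pow_mul]; positivity
          gcongr ?_ * ?_
          exact setIntegral_mono_on (hint k).abs (hf.abs.const_mul _) measurableSet_Ioi (hbound k)
      _ = besselCoeff a k * (R * z / 2) ^ (2 * k) * ∫ u in Ioi 0, |u ^ (2 * a + 1) * f u| := by
          rw [integral_const_mul, mul_div_assoc, mul_pow]
          ring

/-- The kernel `(w² - u²)₊ ^ (b - 1)` of fractional integration of order `b` with respect to the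
squared variable. -/
def sonineKernel (b w u : ℝ) : ℝ := if u < w then (w ^ 2 - u ^ 2) ^ (b - 1) else 0

theorem sonineKernel_nonneg {u : ℝ} (hu : 0 < u) : 0 ≤ sonineKernel b w u := by
  unfold sonineKernel
  split_ifs with h
  · exact Real.rpow_nonneg (by nlinarith) _
  · exact le_rfl

theorem rpow_mul_sonineKernel (c b w : ℝ) :
    (fun u => u ^ c * sonineKernel b w u)
      = (Iio w).indicator fun u => u ^ c * (w ^ 2 - u ^ 2) ^ (b - 1) := by
  ext u
  simp only [sonineKernel, mul_ite, mul_zero, indicator_apply, mem_Iio]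

theorem integral_rpow_mul_sonineKernel (ha : -1 < a) (hb : 0 < b) (hw : 0 < w) :
    ∫ u in Ioi 0, u ^ (2 * a + 1) * sonineKernel b w u
      = w ^ (2 * (a + b)) * (ProbabilityTheory.beta (a + 1) b / 2) := by
  rw [rpow_mul_sonineKernel, setIntegral_indicator measurableSet_Iio, Ioi_inter_Iio,
    show 2 * a + 1 = 2 * a + 2 - 1 by ring,
    integral_rpow_mul_sq_sub_sq_rpow (by linarith) hb hw]
  ring_nf

theorem integrableOn_rpow_mul_sonineKernel (ha : -1 < a) (hb : 0 < b) (hw : 0 < w) :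
    IntegrableOn (fun u => u ^ (2 * a + 1) * sonineKernel b w u) (Ioi 0) := by
  have hbeta := ProbabilityTheory.beta_pos (show 0 < a + 1 by linarith) hb
  refine Integrable.of_integral_ne_zero ?_
  rw [integral_rpow_mul_sonineKernel ha hb hw]
  positivity

-- Sonine's first integral.
theorem hankel_sonineKernel (ha : -1 < a) (hb : 0 < b) (hw : 0 < w) (z : ℝ) :
    hankel a (sonineKernel b w) z
      = Real.Gamma b / 2 * w ^ (2 * (a + b)) * besselEntire (a + b) (w * z) := by
  refine (hasSum_hankel_of_eq_zero ha z (integrableOn_rpow_mul_sonineKernel ha hb hw)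
    (R := w) fun u hu => if_neg hu.not_gt).unique
    (((hasSum_besselEntire (by linarith) (w * z)).mul_left _).congr_fun fun k => ?_)
  have hΓ := Real.Gamma_pos_of_pos (show 0 < k + a + 1 by linarith)
  have hpow : w ^ (2 * (a + k + b)) = w ^ (2 * (a + b)) * w ^ (2 * k) := by
    rw [← Real.rpow_natCast w, ← Real.rpow_add hw]
    push_cast
    ring_nf
  rw [integral_rpow_mul_sonineKernel (by linarith) hb hw, hpow, ProbabilityTheory.beta,
    besselCoeff, besselCoeff, mul_div_assoc w, mul_pow, show a + k + 1 = k + a + 1 by ring,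
    show k + a + 1 + b = k + (a + b) + 1 by ring]
  field_simp

theorem abs_hankel_le {C : ℝ} (hC : ∀ x, |besselEntire a x| ≤ C)
    (hf : IntegrableOn (fun u => u ^ (2 * a + 1) * f u) (Ioi 0)) (z : ℝ) :
    |hankel a f z| ≤ C * ∫ u in Ioi 0, |u ^ (2 * a + 1) * f u| := by
  rw [hankel, ← integral_const_mul, ← Real.norm_eq_abs]
  refine norm_integral_le_of_norm_le (hf.abs.const_mul C) (ae_of_all _ fun u => ?_)
  rw [norm_mul]
  exact mul_le_mul_of_nonneg_right (hC _) (abs_nonneg _)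

-- By Sonine's integral `besselEntire (-1/2 + b)` is an average of `besselEntire (-1/2)`, a cosine.
theorem abs_besselEntire_le (ha : -(1 / 2) ≤ a) (x : ℝ) :
    |besselEntire a x| ≤ 1 / Real.Gamma (a + 1) := by
  have hcos : ∀ x, |besselEntire (-(1 / 2)) x| ≤ besselEntire (-(1 / 2)) 0 := fun x => by
    rw [besselEntire_neg_half, besselEntire_neg_half, Real.cos_zero, abs_div,
      abs_of_nonneg (Real.sqrt_nonneg _)]
    gcongr
    exact Real.abs_cos_le_one x
  rw [← besselEntire_zero (by linarith)]
  rcases ha.eq_or_lt with rfl | ha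
  · exact hcos x
  obtain ⟨b, hb, rfl⟩ : ∃ b, 0 < b ∧ a = -(1 / 2) + b := ⟨a + 1 / 2, by linarith, by ring⟩
  have hΓ : 0 < Real.Gamma b / 2 := half_pos (Real.Gamma_pos_of_pos hb)
  have hsonine := hankel_sonineKernel (a := -(1 / 2)) (by norm_num) hb one_pos
  have hint := integrableOn_rpow_mul_sonineKernel (a := -(1 / 2)) (by norm_num) hb one_pos
  have hzero : besselEntire (-(1 / 2)) 0 *
      ∫ u in Ioi 0, |u ^ (2 * -(1 / 2) + 1 : ℝ) * sonineKernel b 1 u|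
        = hankel (-(1 / 2)) (sonineKernel b 1) 0 := by
    rw [hankel, ← integral_const_mul]
    refine setIntegral_congr_fun measurableSet_Ioi fun u hu => ?_
    have hnonneg : 0 ≤ u ^ (2 * -(1 / 2) + 1 : ℝ) * sonineKernel b 1 u :=
      mul_nonneg (Real.rpow_nonneg (le_of_lt hu) _) (sonineKernel_nonneg hu)
    simp only [mul_zero, abs_of_nonneg hnonneg]
  have hle := (abs_hankel_le hcos hint x).trans_eq hzero
  simp only [hsonine, Real.one_rpow, mul_one, one_mul, abs_mul, abs_of_pos hΓ] at hle
  exact le_of_mul_le_mul_left hle hΓ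

theorem integrableOn_besselEntire_mul (ha : -(1 / 2) ≤ a)
    (hf : IntegrableOn (fun u => u ^ (2 * a + 1) * f u) (Ioi 0)) (z : ℝ) :
    IntegrableOn (fun u => besselEntire a (u * z) * (u ^ (2 * a + 1) * f u)) (Ioi 0) := by
  have hmeas : Measurable fun u => besselEntire a (u * z) :=
    (measurable_besselEntire (by linarith)).comp (measurable_id.mul_const z)
  exact Integrable.bdd_mul hf hmeas.aestronglyMeasurable
    (ae_of_all _ fun u => abs_besselEntire_le ha _)

theorem hankel_congr (hfg : EqOn f g (Ioi 0)) (a z : ℝ) : hankel a f z = hankel a g z :=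
  setIntegral_congr_fun measurableSet_Ioi fun u hu => by simp only [hfg hu]

theorem hankel_const_mul (a c : ℝ) (f : ℝ → ℝ) (z : ℝ) :
    hankel a (fun u => c * f u) z = c * hankel a f z := by
  rw [hankel, hankel, ← integral_const_mul]
  congr with u
  ring

theorem hankel_sub (ha : -(1 / 2) ≤ a)
    (hf : IntegrableOn (fun u => u ^ (2 * a + 1) * f u) (Ioi 0))
    (hg : IntegrableOn (fun u => u ^ (2 * a + 1) * g u) (Ioi 0)) (z : ℝ) :
    hankel a (f - g) z = hankel a f z - hankel a g z := by
  rw [hankel, hankel, hankel, ← integral_sub (integrableOn_besselEntire_mul ha hf z)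
    (integrableOn_besselEntire_mul ha hg z)]
  simp only [Pi.sub_apply, mul_sub]

end HankelTransform

section WeylIntegral

variable {a ν w : ℝ} {f : ℝ → ℝ}

/-- The Weyl fractional integral of order `ν` with respect to the squared variable. -/
def weylIntegral (ν : ℝ) (f : ℝ → ℝ) (r : ℝ) : ℝ :=
  2 / Real.Gamma ν * ∫ w in Ioi r, w * (w ^ 2 - r ^ 2) ^ (ν - 1) * f w

/-- The integrand of the double integral `∫ u ^ (2 * a + 1) * weylIntegral ν f u du`. -/
def weylKernel (a ν : ℝ) (f : ℝ → ℝ) (u w : ℝ) : ℝ :=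
  u ^ (2 * a + 1) * sonineKernel ν w u * (2 / Real.Gamma ν * w * f w)

theorem measurable_weylKernel (a ν : ℝ) (hf : Measurable f) :
    Measurable (Function.uncurry (weylKernel a ν f)) := by
  have hK : Measurable fun p : ℝ × ℝ => sonineKernel ν p.2 p.1 :=
    Measurable.ite (measurableSet_lt measurable_fst measurable_snd) (by fun_prop)
      measurable_const
  unfold weylKernel Function.uncurry
  fun_prop

theorem integral_weylKernel_right (a ν : ℝ) (f : ℝ → ℝ) {u : ℝ} (hu : 0 < u) :
    ∫ w in Ioi 0, weylKernel a ν f u w = u ^ (2 * a + 1) * weylIntegral ν f u := by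
  have hind : weylKernel a ν f u = (Ioi u).indicator fun w =>
      u ^ (2 * a + 1) * (2 / Real.Gamma ν) * (w * (w ^ 2 - u ^ 2) ^ (ν - 1) * f w) := by
    ext w
    simp only [weylKernel, sonineKernel, indicator_apply, mem_Ioi]
    split_ifs <;> ring
  rw [hind, setIntegral_indicator measurableSet_Ioi, Ioi_inter_Ioi, sup_eq_right.2 hu.le,
    integral_const_mul, weylIntegral, mul_assoc]

theorem integral_abs_weylKernel_left (ha : -1 < a) (hν : 0 < ν) (f : ℝ → ℝ) (hw : 0 < w) :
    ∫ u in Ioi 0, |weylKernel a ν f u w|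
      = ProbabilityTheory.beta (a + 1) ν / Real.Gamma ν * |w ^ (2 * (a + ν) + 1) * f w| := by
  have habs : EqOn (fun u => |weylKernel a ν f u w|)
      (fun u => u ^ (2 * a + 1) * sonineKernel ν w u * (2 / Real.Gamma ν * w * |f w|))
      (Ioi 0) := fun u hu => by
    simp only [weylKernel]
    rw [abs_mul, abs_of_nonneg
      (mul_nonneg (Real.rpow_nonneg (le_of_lt hu) _) (sonineKernel_nonneg hu)), abs_mul,
      abs_of_pos (by positivity)]
  rw [setIntegral_congr_fun measurableSet_Ioi habs, integral_mul_const,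
    integral_rpow_mul_sonineKernel ha hν hw, Real.rpow_add_one hw.ne', abs_mul,
    abs_of_pos (show 0 < w ^ (2 * (a + ν)) * w by positivity)]
  ring

theorem integrable_weylKernel (ha : -1 < a) (hν : 0 < ν) (hf : Measurable f)
    (hint : IntegrableOn (fun w => w ^ (2 * (a + ν) + 1) * f w) (Ioi 0)) :
    Integrable (Function.uncurry (weylKernel a ν f))
      ((volume.restrict (Ioi 0)).prod (volume.restrict (Ioi 0))) := by
  rw [integrable_prod_iff' (measurable_weylKernel a ν hf).aestronglyMeasurable]
  refine ⟨ae_restrict_of_forall_mem measurableSet_Ioi fun w hw =>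
    (integrableOn_rpow_mul_sonineKernel ha hν hw).mul_const (2 / Real.Gamma ν * w * f w), ?_⟩
  exact (integrableOn_congr_fun (fun w hw => integral_abs_weylKernel_left ha hν f hw)
    measurableSet_Ioi).2 (hint.abs.const_mul _)

theorem integrableOn_rpow_mul_weylIntegral (ha : -1 < a) (hν : 0 < ν) (hf : Measurable f)
    (hint : IntegrableOn (fun w => w ^ (2 * (a + ν) + 1) * f w) (Ioi 0)) :
    IntegrableOn (fun u => u ^ (2 * a + 1) * weylIntegral ν f u) (Ioi 0) :=
  (integrableOn_congr_fun (fun _ hu => integral_weylKernel_right a ν f hu) measurableSet_Ioi).1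
    (integrable_weylKernel ha hν hf hint).integral_prod_left

theorem integral_besselEntire_mul_weylKernel (ha : -1 < a) (hν : 0 < ν) (f : ℝ → ℝ) (hw : 0 < w)
    (z : ℝ) :
    ∫ u in Ioi 0, besselEntire a (u * z) * weylKernel a ν f u w
      = besselEntire (a + ν) (w * z) * (w ^ (2 * (a + ν) + 1) * f w) := by
  calc ∫ u in Ioi 0, besselEntire a (u * z) * weylKernel a ν f u w
      = hankel a (sonineKernel ν w) z * (2 / Real.Gamma ν * w * f w) := by
        rw [hankel, ← integral_mul_const]
        simp only [weylKernel, mul_assoc]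
    _ = besselEntire (a + ν) (w * z) * (w ^ (2 * (a + ν) + 1) * f w) := by
        rw [hankel_sonineKernel ha hν hw, Real.rpow_add_one hw.ne']
        field_simp

theorem hankel_weylIntegral (ha : -(1 / 2) ≤ a) (hν : 0 < ν) (hf : Measurable f)
    (hint : IntegrableOn (fun w => w ^ (2 * (a + ν) + 1) * f w) (Ioi 0)) (z : ℝ) :
    hankel a (weylIntegral ν f) z = hankel (a + ν) f z := by
  have ha' : -1 < a := by linarith
  have hbessel : Measurable fun p : ℝ × ℝ => besselEntire a (p.1 * z) :=
    (measurable_besselEntire ha').comp (measurable_fst.mul_const z)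
  have hprod : Integrable
      (Function.uncurry fun u w => besselEntire a (u * z) * weylKernel a ν f u w)
      ((volume.restrict (Ioi 0)).prod (volume.restrict (Ioi 0))) :=
    (integrable_weylKernel ha' hν hf hint).bdd_mul hbessel.aestronglyMeasurable
      (ae_of_all _ fun p => abs_besselEntire_le ha _)
  calc hankel a (weylIntegral ν f) z
      = ∫ u in Ioi 0, ∫ w in Ioi 0, besselEntire a (u * z) * weylKernel a ν f u w :=
        setIntegral_congr_fun measurableSet_Ioi fun u hu => by
          simp only [integral_const_mul, integral_weylKernel_right a ν f hu]
    _ = ∫ w in Ioi 0, ∫ u in Ioi 0, besselEntire a (u * z) * weylKernel a ν f u w :=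
        integral_integral_swap hprod
    _ = hankel (a + ν) f z := setIntegral_congr_fun measurableSet_Ioi fun w hw =>
        integral_besselEntire_mul_weylKernel ha' hν f hw z

end WeylIntegral

section GeneralizedWendland

variable {a p ν μ δ r w z : ℝ} {d : ℕ}

/-- The Askey function `(1 - w / δ)₊ ^ μ`. -/
def askey (δ μ w : ℝ) : ℝ := max 0 (1 - w / δ) ^ μ

theorem measurable_askey (δ μ : ℝ) : Measurable (askey δ μ) := by
  unfold askey
  fun_prop

theorem askey_nonneg (δ μ w : ℝ) : 0 ≤ askey δ μ w := Real.rpow_nonneg (le_max_left _ _) _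

theorem askey_of_le (hδ : 0 < δ) (hw : w ≤ δ) : askey δ μ w = (1 - w / δ) ^ μ := by
  rw [askey, max_eq_right (sub_nonneg.2 ((div_le_one hδ).2 hw))]

theorem askey_of_ge (hδ : 0 < δ) (hμ : 0 < μ) (hw : δ ≤ w) : askey δ μ w = 0 := by
  rw [askey, max_eq_left (sub_nonpos.2 ((one_le_div hδ).2 hw)), Real.zero_rpow hμ.ne']

theorem integral_rpow_mul_askey (hp : -1 < p) (hδ : 0 < δ) (hμ : 0 < μ) :
    ∫ w in Ioi 0, w ^ p * askey δ μ w = δ ^ (p + 1) * ProbabilityTheory.beta (p + 1) (μ + 1) := by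
  have hind : (fun w => w ^ p * askey δ μ w) = (Iio δ).indicator
      fun w => δ ^ (-μ) * (w ^ (p + 1 - 1) * (δ - w) ^ (μ + 1 - 1)) := by
    ext w
    rw [indicator_apply]
    split_ifs with h
    · rw [askey_of_le hδ (le_of_lt h), one_sub_div hδ.ne',
        Real.div_rpow (sub_nonneg.2 (le_of_lt h)) hδ.le, Real.rpow_neg hδ.le, add_sub_cancel_right,
        add_sub_cancel_right]
      ring
    · rw [askey_of_ge hδ hμ (not_lt.1 h), mul_zero]
  rw [hind, setIntegral_indicator measurableSet_Iio, Ioi_inter_Iio, integral_const_mul,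
    integral_rpow_mul_sub_rpow (by linarith) (by linarith) hδ, ← mul_assoc, ← Real.rpow_add hδ]
  ring_nf

theorem integrableOn_rpow_mul_askey (hp : -1 < p) (hδ : 0 < δ) (hμ : 0 < μ) :
    IntegrableOn (fun w => w ^ p * askey δ μ w) (Ioi 0) := by
  have hbeta := ProbabilityTheory.beta_pos (show 0 < p + 1 by linarith) (show 0 < μ + 1 by linarith)
  refine Integrable.of_integral_ne_zero ?_
  rw [integral_rpow_mul_askey hp hδ hμ]
  positivity

theorem Gamma_natCast_add_eq_ascPochhammer {x : ℝ} (hx : 0 < x) (k : ℕ) :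
    Real.Gamma (k + x) = (ascPochhammer ℝ k).eval x * Real.Gamma x := by
  induction k with
  | zero => simp
  | succ k ih =>
    have h0 : (k : ℝ) + x ≠ 0 := by positivity
    rw [show ((k + 1 : ℕ) : ℝ) + x = (k + x) + 1 by push_cast; ring, Real.Gamma_add_one h0, ih,
      ascPochhammer_succ_eval]
    ring

theorem Gamma_two_mul_natCast_add_eq_ascPochhammer {x : ℝ} (hx : 0 < x) (k : ℕ) :
    Real.Gamma (2 * k + 2 * x) = 2 ^ (2 * k) * (ascPochhammer ℝ k).eval x *
      (ascPochhammer ℝ k).eval (x + 1 / 2) * Real.Gamma (2 * x) := by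
  induction k with
  | zero => simp
  | succ k ih =>
    have h0 : (2 : ℝ) * k + 2 * x ≠ 0 := by positivity
    have h1 : (2 : ℝ) * k + 2 * x + 1 ≠ 0 := by positivity
    rw [show (2 : ℝ) * ((k + 1 : ℕ) : ℝ) + 2 * x = (2 * k + 2 * x + 1) + 1 by push_cast; ring,
      Real.Gamma_add_one h1, Real.Gamma_add_one h0, ih,
      ascPochhammer_succ_eval, ascPochhammer_succ_eval]
    ring

theorem hankel_askey (ha : -1 < a) (hδ : 0 < δ) (hμ : 0 < μ) (z : ℝ) :
    hankel a (askey δ μ) z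
      = δ ^ (2 * a + 2) * Real.Gamma (2 * a + 2) * Real.Gamma (μ + 1) /
          (Real.Gamma (a + 1) * Real.Gamma (2 * a + μ + 3)) *
        hypergeometric1F2 (a + 3 / 2) (a + 3 / 2 + μ / 2) (a + 3 / 2 + (μ + 1) / 2)
          (-(z * δ) ^ 2 / 4) := by
  rw [← (hasSum_hankel_of_eq_zero ha z (integrableOn_rpow_mul_askey (by linarith) hδ hμ)
    (R := δ) fun u hu => askey_of_ge hδ hμ (le_of_lt hu)).tsum_eq, hypergeometric1F2,
    ← tsum_mul_left]
  refine tsum_congr fun k => ?_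
  have hA : 0 < a + 1 := by linarith
  have hB : 0 < a + 3 / 2 + μ / 2 := by linarith
  have hδpow : δ ^ (2 * (a + k) + 1 + 1) = δ ^ (2 * a + 2) * δ ^ (2 * k) := by
    rw [← Real.rpow_natCast, ← Real.rpow_add hδ]
    push_cast
    ring_nf
  have hzpow : (-(z * δ) ^ 2 / 4) ^ k = (-1) ^ k * (z / 2) ^ (2 * k) * δ ^ (2 * k) := by
    rw [pow_mul, pow_mul, ← mul_pow, ← mul_pow]
    ring_nf
  have hΓA := Gamma_two_mul_natCast_add_eq_ascPochhammer hA k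
  have hΓB := Gamma_two_mul_natCast_add_eq_ascPochhammer hB k
  rw [show a + 1 + 1 / 2 = a + 3 / 2 by ring] at hΓA
  rw [show a + 3 / 2 + μ / 2 + 1 / 2 = a + 3 / 2 + (μ + 1) / 2 by ring] at hΓB
  rw [integral_rpow_mul_askey (by linarith) hδ hμ, ProbabilityTheory.beta, besselCoeff, hδpow,
    hzpow, show (k : ℝ) + a + 1 = k + (a + 1) by ring, Gamma_natCast_add_eq_ascPochhammer hA,
    show 2 * (a + k) + 1 + 1 + (μ + 1) = 2 * k + 2 * (a + 3 / 2 + μ / 2) by ring, hΓB,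
    show 2 * (a + k) + 1 + 1 = 2 * k + 2 * (a + 1) by ring, hΓA,
    show 2 * (a + 1) = 2 * a + 2 by ring,
    show 2 * (a + 3 / 2 + μ / 2) = 2 * a + μ + 3 by ring]
  have hposA := ascPochhammer_pos k (a + 1) hA
  field_simp

/-- The constant by which the generalized Wendland function differs from the Weyl integral of order
`ν` of the Askey function. -/
def wendlandCoeff (ν μ δ : ℝ) : ℝ :=
  gammaRatio ν / 2 * (Real.Gamma (μ + 2 * ν + 1) / Real.Gamma (μ + 1)) * δ ^ (-(2 * ν))

theorem wendlandCoeff_zero (hμ : 0 < μ) (δ : ℝ) : wendlandCoeff 0 μ δ = 1 := by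
  have hΓ := Real.Gamma_pos_of_pos (show 0 < μ + 1 by linarith)
  simp [wendlandCoeff, gammaRatio, hΓ.ne']

theorem weylIntegral_askey_of_le (ν : ℝ) (hδ : 0 < δ) (hμ : 0 < μ) (hr : r ≤ δ) :
    weylIntegral ν (askey δ μ) r
      = 2 / Real.Gamma ν * ∫ w in r..δ, w * (w ^ 2 - r ^ 2) ^ (ν - 1) * (1 - w / δ) ^ μ := by
  rw [weylIntegral, intervalIntegral.integral_of_le hr]
  congr 1
  refine (setIntegral_eq_of_subset_of_forall_sdiff_eq_zero measurableSet_Ioi Ioc_subset_Ioi_self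
    fun w hw => ?_).trans (setIntegral_congr_fun measurableSet_Ioc fun w hw => ?_)
  · have hδw : δ ≤ w := le_of_not_ge fun hle => hw.2 ⟨hw.1, hle⟩
    rw [askey_of_ge hδ hμ hδw, mul_zero]
  · simp only [askey_of_le hδ hw.2]

theorem integral_mul_sq_sub_sq_rpow_mul_one_sub_div_rpow (ν μ : ℝ) (hδ : 0 < δ) (hr : 0 ≤ r)
    (hrδ : r ≤ δ) :
    ∫ w in r..δ, w * (w ^ 2 - r ^ 2) ^ (ν - 1) * (1 - w / δ) ^ μ
      = δ ^ (2 * ν) *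
        ∫ u in (r / δ)..1, u * (u ^ 2 - (r / δ) ^ 2) ^ (ν - 1) * (1 - u) ^ μ := by
  have hscale := intervalIntegral.integral_comp_div (a := r) (b := δ)
    (fun u => u * (u ^ 2 - (r / δ) ^ 2) ^ (ν - 1) * (1 - u) ^ μ) hδ.ne'
  rw [div_self hδ.ne', smul_eq_mul] at hscale
  rw [show 2 * ν = 2 * ν - 1 + 1 by ring, Real.rpow_add_one hδ.ne', mul_assoc, ← hscale,
    ← intervalIntegral.integral_const_mul]
  refine intervalIntegral.integral_congr fun w hw => ?_
  rw [uIcc_of_le hrδ] at hw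
  have hsq : 0 ≤ w ^ 2 - r ^ 2 := by nlinarith [hw.1]
  have hδpow : δ ^ (2 * ν - 1) = (δ ^ 2) ^ (ν - 1) * δ := by
    rw [← Real.rpow_natCast_mul hδ.le, ← Real.rpow_add_one hδ.ne']
    push_cast
    ring_nf
  simp only [show (w / δ) ^ 2 - (r / δ) ^ 2 = (w ^ 2 - r ^ 2) / δ ^ 2 by field_simp,
    Real.div_rpow hsq (sq_nonneg δ), hδpow]
  field_simp

theorem genWendland_eq_weylIntegral (hν : 0 < ν) (hδ : 0 < δ) (hμ : 0 < μ) (hr : 0 ≤ r) :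
    genWendland ν μ δ r = wendlandCoeff ν μ δ * weylIntegral ν (askey δ μ) r := by
  rw [genWendland, if_neg hν.ne']
  split_ifs with h
  · have hcoeff : 1 / ProbabilityTheory.beta (2 * ν) (μ + 1)
        = wendlandCoeff ν μ δ * (2 / Real.Gamma ν) * δ ^ (2 * ν) := by
      rw [wendlandCoeff, gammaRatio, if_neg hν.ne', ProbabilityTheory.beta,
        show 2 * ν + (μ + 1) = μ + 2 * ν + 1 by ring, Real.rpow_neg hδ.le]
      field_simp
    rw [weylIntegral_askey_of_le ν hδ hμ h,
      integral_mul_sq_sub_sq_rpow_mul_one_sub_div_rpow ν μ hδ hr h, hcoeff]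
    ring
  · have hzero : ∀ w ∈ Ioi r, w * (w ^ 2 - r ^ 2) ^ (ν - 1) * askey δ μ w = 0 := fun w hw => by
      rw [askey_of_ge hδ hμ ((not_le.1 h).trans hw).le, mul_zero]
    rw [weylIntegral, setIntegral_eq_zero_of_forall_eq_zero hzero, mul_zero, mul_zero]

theorem genWendland_zero (hδ : 0 < δ) (hμ : 0 < μ) : genWendland 0 μ δ = askey δ μ := by
  ext r
  rw [genWendland, if_pos rfl]
  split_ifs with h
  · rw [askey_of_le hδ h]
  · rw [askey_of_ge hδ hμ (not_le.1 h).le]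

theorem integrableOn_rpow_mul_genWendland (ha : -1 < a) (hν : 0 ≤ ν) (hδ : 0 < δ) (hμ : 0 < μ) :
    IntegrableOn (fun r => r ^ (2 * a + 1) * genWendland ν μ δ r) (Ioi 0) := by
  rcases hν.eq_or_lt with rfl | hν
  · rw [genWendland_zero hδ hμ]
    exact integrableOn_rpow_mul_askey (by linarith) hδ hμ
  · refine (integrableOn_congr_fun (fun r hr => ?_) measurableSet_Ioi).2
      ((integrableOn_rpow_mul_weylIntegral ha hν (measurable_askey δ μ)
        (integrableOn_rpow_mul_askey (by linarith) hδ hμ)).const_mul (wendlandCoeff ν μ δ))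
    rw [genWendland_eq_weylIntegral hν hδ hμ (le_of_lt hr)]
    ring

theorem hankel_genWendland (ha : -(1 / 2) ≤ a) (hν : 0 ≤ ν) (hδ : 0 < δ) (hμ : 0 < μ) (z : ℝ) :
    hankel a (genWendland ν μ δ) z = wendlandCoeff ν μ δ * hankel (a + ν) (askey δ μ) z := by
  rcases hν.eq_or_lt with rfl | hν
  · rw [genWendland_zero hδ hμ, wendlandCoeff_zero hμ, one_mul, add_zero]
  · rw [hankel_congr fun r hr => genWendland_eq_weylIntegral hν hδ hμ (le_of_lt hr),
      hankel_const_mul, hankel_weylIntegral ha hν (measurable_askey δ μ)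
        (integrableOn_rpow_mul_askey (by linarith) hδ hμ)]

theorem two_rpow_div_two_mul_pi_rpow (s : ℝ) :
    (2 : ℝ) ^ (1 - s / 2) / (2 * Real.pi) ^ (s / 2) = 2 * (2 ^ (-s) * Real.pi ^ (-s / 2)) := by
  have hpow : (2 : ℝ) ^ s = 2 ^ (s / 2) * 2 ^ (s / 2) := by
    rw [← Real.rpow_add two_pos, add_halves]
  rw [Real.mul_rpow zero_le_two Real.pi_pos.le, neg_div, Real.rpow_neg Real.pi_pos.le,
    Real.rpow_neg zero_le_two, Real.rpow_sub two_pos, Real.rpow_one, hpow]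
  field_simp

theorem neg_half_le_half_sub_one (hd : 1 ≤ d) : -(1 / 2) ≤ (d : ℝ) / 2 - 1 := by
  have : (1 : ℝ) ≤ d := Nat.one_le_cast.2 hd
  linarith

theorem spectralDensity_genWendland (hd : 1 ≤ d) (hν : 0 ≤ ν) (hδ : 0 < δ) (hμ : 0 < μ)
    (hz : 0 < z) :
    spectralDensity d (genWendland ν μ δ) z = genWendlandDensity d ν μ δ z := by
  have ha := neg_half_le_half_sub_one hd
  have hδpow : δ ^ (2 * ν + d) = δ ^ (2 * ν) * δ ^ d := by
    rw [Real.rpow_add hδ, Real.rpow_natCast]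
  rw [spectralDensity_eq_hankel d _ hz, two_rpow_div_two_mul_pi_rpow,
    hankel_genWendland ha hν hδ hμ, hankel_askey (by linarith) hδ hμ, genWendlandDensity,
    wendlandCoeff, show (d : ℝ) / 2 - 1 + ν + 3 / 2 = lam d ν by unfold lam; ring,
    show 2 * ((d : ℝ) / 2 - 1 + ν) + 2 = 2 * ν + d by ring,
    show (d : ℝ) / 2 - 1 + ν + 1 = ν + d / 2 by ring,
    show 2 * ((d : ℝ) / 2 - 1 + ν) + μ + 3 = μ + 2 * ν + d + 1 by ring, hδpow,
    Real.rpow_neg hδ.le]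
  field_simp

end GeneralizedWendland

section BesselK

variable {b β r x : ℝ}

/-- The integrand of the representation `2 * (x / 2) ^ b * K_b(x) = ∫ s, maternIntegrand b x s`,
which exhibits the Matérn function as a scale mixture of Gaussians. -/
def maternIntegrand (b x s : ℝ) : ℝ :=
  s ^ (b - 1) * Real.exp (-s) * Real.exp (-(x ^ 2 / (4 * s)))

theorem integrableOn_rpow_mul_exp_neg (hb : 0 < b) :
    IntegrableOn (fun s => s ^ (b - 1) * Real.exp (-s)) (Ioi 0) := by
  simpa only [Real.rpow_one] using
    integrableOn_rpow_mul_exp_neg_rpow (p := 1) (s := b - 1) (by linarith) one_pos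

theorem integrableOn_maternIntegrand (hb : 0 < b) (x : ℝ) :
    IntegrableOn (maternIntegrand b x) (Ioi 0) := by
  have hmeas : Measurable (maternIntegrand b x) := by
    unfold maternIntegrand
    fun_prop
  refine (integrableOn_rpow_mul_exp_neg hb).mono' hmeas.aestronglyMeasurable
    (ae_restrict_of_forall_mem measurableSet_Ioi fun s hs => ?_)
  have hs : 0 < s := hs
  rw [maternIntegrand, Real.norm_of_nonneg (by positivity)]
  refine mul_le_of_le_one_right (by positivity) (Real.exp_le_one_iff.2 (neg_nonpos.2 ?_))
  positivity

theorem integrable_exp_mul_comp_exp_iff (g : ℝ → ℝ) :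
    Integrable (fun t => Real.exp t * g (Real.exp t)) ↔ IntegrableOn g (Ioi 0) := by
  have h := integrableOn_image_iff_integrableOn_abs_deriv_smul MeasurableSet.univ
    (fun t _ => (Real.hasDerivAt_exp t).hasDerivWithinAt) Real.exp_injective.injOn g
  simpa only [image_univ, Real.range_exp, Real.abs_exp, smul_eq_mul, integrableOn_univ]
    using h.symm

theorem integral_exp_mul_comp_exp (g : ℝ → ℝ) :
    ∫ t, Real.exp t * g (Real.exp t) = ∫ s in Ioi 0, g s := by
  have h := integral_image_eq_integral_abs_deriv_smul MeasurableSet.univ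
    (fun t _ => (Real.hasDerivAt_exp t).hasDerivWithinAt) Real.exp_injective.injOn g
  simpa only [image_univ, Real.range_exp, Real.abs_exp, smul_eq_mul, setIntegral_univ]
    using h.symm

theorem rpow_mul_exp_neg_mul_cosh_mul_exp (b : ℝ) (hx : 0 < x) (t : ℝ) :
    (x / 2) ^ b * (Real.exp (-x * Real.cosh t) * Real.exp (b * t))
      = Real.exp (t + Real.log (x / 2)) *
          maternIntegrand b x (Real.exp (t + Real.log (x / 2))) := by
  have hs : 0 < Real.exp t * (x / 2) := by positivity
  have hcosh : -x * Real.cosh t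
      = -(Real.exp t * (x / 2)) + -(x ^ 2 / (4 * (Real.exp t * (x / 2)))) := by
    rw [Real.cosh_eq, Real.exp_neg]
    field_simp
    ring
  rw [Real.exp_add t, Real.exp_log (half_pos hx), maternIntegrand, Real.rpow_sub_one hs.ne',
    Real.mul_rpow (Real.exp_pos t).le (half_pos hx).le, ← Real.exp_mul, hcosh, Real.exp_add,
    mul_comm t b]
  field_simp

theorem integrable_exp_neg_mul_cosh_mul_exp (hb : 0 < b) (hx : 0 < x) :
    Integrable fun t => Real.exp (-x * Real.cosh t) * Real.exp (b * t) := by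
  have h := ((integrable_exp_mul_comp_exp_iff _).2
    (integrableOn_maternIntegrand hb x)).comp_add_right (Real.log (x / 2))
  simp only [← rpow_mul_exp_neg_mul_cosh_mul_exp b hx] at h
  exact (integrable_const_mul_iff (Real.rpow_pos_of_pos (half_pos hx) b).ne'.isUnit _).1 h

theorem rpow_mul_integral_exp_neg_mul_cosh_mul_exp (b : ℝ) (hx : 0 < x) :
    (x / 2) ^ b * ∫ t, Real.exp (-x * Real.cosh t) * Real.exp (b * t)
      = ∫ s in Ioi 0, maternIntegrand b x s := by
  rw [← integral_const_mul, ← integral_exp_mul_comp_exp,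
    ← integral_add_right_eq_self (fun t => Real.exp t * maternIntegrand b x (Real.exp t))
      (Real.log (x / 2))]
  simp only [rpow_mul_exp_neg_mul_cosh_mul_exp b hx]

theorem integral_exp_neg_mul_cosh_mul_exp (hb : 0 < b) (hx : 0 < x) :
    ∫ t, Real.exp (-x * Real.cosh t) * Real.exp (b * t) = 2 * besselK b x := by
  have hint := integrable_exp_neg_mul_cosh_mul_exp hb hx
  have hneg := integral_neg_eq_self
    (fun t => Real.exp (-x * Real.cosh t) * Real.exp (b * t)) volume
  have heven : ∀ t, Real.exp (-x * Real.cosh |t|) * Real.cosh (b * |t|)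
      = (Real.exp (-x * Real.cosh t) * Real.exp (b * t) +
          Real.exp (-x * Real.cosh (-t)) * Real.exp (b * -t)) / 2 := fun t => by
    rw [Real.cosh_abs, Real.cosh_neg, show Real.cosh (b * |t|) = Real.cosh (b * t) by
      rcases abs_choice t with h | h <;> rw [h]; rw [mul_neg, Real.cosh_neg], Real.cosh_eq (b * t)]
    ring_nf
  rw [besselK, ← integral_comp_abs
    (f := fun t => Real.exp (-x * Real.cosh t) * Real.cosh (b * t))]
  simp only [heven]
  rw [integral_div, integral_add hint hint.comp_neg, hneg]
  ring

theorem Gamma_mul_matern (hb : 0 < b) (hβ : 0 < β) (hr : 0 < r) :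
    Real.Gamma b * matern b β r = ∫ s in Ioi 0, maternIntegrand b (r / β) s := by
  have hx := div_pos hr hβ
  rw [← rpow_mul_integral_exp_neg_mul_cosh_mul_exp b hx,
    integral_exp_neg_mul_cosh_mul_exp hb hx, matern, if_neg hr.ne', Real.rpow_sub two_pos,
    Real.rpow_one, Real.div_rpow hx.le zero_le_two]
  field_simp

theorem besselK_half (x : ℝ) :
    besselK (1 / 2) x = Real.exp (-x) * √(Real.pi / (2 * x)) := by
  have himg : (fun t => Real.sinh (t / 2)) '' Ioi 0 = Ioi 0 := by
    ext y
    refine ⟨?_, fun hy => ⟨2 * Real.arsinh y, mul_pos two_pos (Real.arsinh_pos_iff.2 hy), ?_⟩⟩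
    · rintro ⟨t, ht, rfl⟩
      exact Real.sinh_pos_iff.2 (half_pos ht)
    · simp only [mul_div_cancel_left₀ _ (two_ne_zero (α := ℝ)), Real.sinh_arsinh]
  have hderiv : ∀ t ∈ Ioi (0 : ℝ), HasDerivWithinAt (fun t => Real.sinh (t / 2))
      (Real.cosh (t / 2) * (1 / 2)) (Ioi 0) t := fun t _ =>
    ((hasDerivAt_id t).div_const 2).sinh.hasDerivWithinAt
  have hinj : InjOn (fun t => Real.sinh (t / 2)) (Ioi 0) := fun t _ u _ h => by
    linarith [Real.sinh_injective h]
  have hintegrand : ∀ t, Real.exp (-x * Real.cosh t) * Real.cosh (1 / 2 * t)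
      = 2 * Real.exp (-x) * (|Real.cosh (t / 2) * (1 / 2)| •
          Real.exp (-(2 * x) * Real.sinh (t / 2) ^ 2)) := fun t => by
    have hcosh : -x * Real.cosh t = -x + -(2 * x) * Real.sinh (t / 2) ^ 2 := by
      have h := Real.cosh_two_mul (t / 2)
      rw [mul_div_cancel₀ t two_ne_zero, Real.cosh_sq] at h
      linear_combination -x * h
    rw [hcosh, Real.exp_add, abs_of_pos (mul_pos (Real.cosh_pos _) one_half_pos), smul_eq_mul,
      one_div_mul_eq_div]
    ring
  calc besselK (1 / 2) x = 2 * Real.exp (-x) * ∫ y in Ioi 0, Real.exp (-(2 * x) * y ^ 2) := by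
        rw [← himg, integral_image_eq_integral_abs_deriv_smul measurableSet_Ioi hderiv hinj,
          besselK, ← integral_const_mul]
        simp only [hintegrand]
    _ = Real.exp (-x) * √(Real.pi / (2 * x)) := by
        rw [integral_gaussian_Ioi]
        ring

theorem matern_half (hβ : 0 < β) (hr : 0 < r) : matern (1 / 2) β r = Real.exp (-(r / β)) := by
  rw [matern, if_neg hr.ne', besselK_half, Real.Gamma_one_half_eq, ← Real.sqrt_eq_rpow,
    show (1 : ℝ) - 1 / 2 = 1 / 2 by norm_num, ← Real.sqrt_eq_rpow,
    Real.sqrt_div Real.pi_pos.le, Real.sqrt_mul zero_le_two]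
  field_simp

end BesselK

section Matern

variable {a b c p β s u z : ℝ} {d : ℕ}

theorem integral_rpow_mul_gaussian (hp : -1 < p) (hc : 0 < c) :
    ∫ u in Ioi 0, u ^ p * Real.exp (-(u ^ 2 / (4 * c)))
      = (4 * c) ^ ((p + 1) / 2) * Real.Gamma ((p + 1) / 2) / 2 := by
  have h := integral_rpow_mul_exp_neg_mul_rpow two_pos hp (inv_pos.2 (mul_pos four_pos hc))
  rw [neg_div, Real.inv_rpow (by positivity), Real.rpow_neg (by positivity), inv_inv] at h
  simp only [div_eq_inv_mul _ (4 * c), ← neg_mul, ← Real.rpow_two, h]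
  ring

theorem integrableOn_rpow_mul_gaussian (hp : -1 < p) (hc : 0 < c) :
    IntegrableOn (fun u => u ^ p * Real.exp (-(u ^ 2 / (4 * c)))) (Ioi 0) := by
  have hΓ := Real.Gamma_pos_of_pos (show 0 < (p + 1) / 2 by linarith)
  refine Integrable.of_integral_ne_zero ?_
  rw [integral_rpow_mul_gaussian hp hc]
  positivity

-- Weber's first exponential integral.
theorem hankel_gaussian (ha : -1 < a) (hc : 0 < c) (z : ℝ) :
    hankel a (fun u => Real.exp (-(u ^ 2 / (4 * c)))) z
      = (4 * c) ^ (a + 1) / 2 * Real.exp (-(z ^ 2 * c)) := by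
  have hp : ∀ k : ℕ, -1 < 2 * (a + k) + 1 := fun k => by
    linarith
  have hterm : ∀ k : ℕ, besselCoeff a k * (z / 2) ^ (2 * k) *
      ∫ u in Ioi 0, u ^ (2 * (a + k) + 1) * Real.exp (-(u ^ 2 / (4 * c)))
        = (4 * c) ^ (a + 1) / 2 * ((z ^ 2 * c) ^ k / k.factorial) := fun k => by
    have hΓ := Real.Gamma_pos_of_pos (show 0 < a + 1 + k by linarith [hp k])
    rw [integral_rpow_mul_gaussian (hp k) hc, besselCoeff,
      show (2 * (a + k) + 1 + 1) / 2 = k + a + 1 by ring,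
      show (k : ℝ) + a + 1 = a + 1 + k by ring, Real.rpow_add_natCast (by positivity),
      show (z ^ 2 * c) ^ k = (z / 2) ^ (2 * k) * (4 * c) ^ k by
        rw [pow_mul, ← mul_pow]
        ring_nf]
    field_simp
  have hexp : ∀ y : ℝ, HasSum (fun k : ℕ => y ^ k / k.factorial) (Real.exp y) := fun y => by
    rw [Real.exp_eq_exp_ℝ]
    exact NormedSpace.expSeries_div_hasSum_exp y
  have habs : ∀ k : ℕ, ∫ u in Ioi 0, |u ^ (2 * (a + k) + 1) * Real.exp (-(u ^ 2 / (4 * c)))|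
      = ∫ u in Ioi 0, u ^ (2 * (a + k) + 1) * Real.exp (-(u ^ 2 / (4 * c))) := fun k =>
    setIntegral_congr_fun measurableSet_Ioi fun u hu =>
      abs_of_nonneg (mul_nonneg (Real.rpow_nonneg (le_of_lt hu) _) (Real.exp_pos _).le)
  refine (hasSum_hankel ha z (fun k => integrableOn_rpow_mul_gaussian (hp k) hc) ?_).unique ?_
  · simp only [habs, hterm]
    exact (hexp _).summable.mul_left _
  · refine ((hexp (-(z ^ 2 * c))).mul_left _).congr_fun fun k => ?_
    rw [mul_assoc, mul_assoc, ← mul_assoc (besselCoeff a k), hterm, neg_pow]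
    ring

/-- The integrand of the double integral `Γ(b) * ∫ u ^ (2 * a + 1) * matern b β u du`. -/
def maternKernel (a b β u s : ℝ) : ℝ := u ^ (2 * a + 1) * maternIntegrand b (u / β) s

theorem maternKernel_eq_mul_gaussian (a b β u s : ℝ) :
    maternKernel a b β u s = s ^ (b - 1) * Real.exp (-s) *
      (u ^ (2 * a + 1) * Real.exp (-(u ^ 2 / (4 * (β ^ 2 * s))))) := by
  rw [maternKernel, maternIntegrand, div_pow, div_div, mul_left_comm (β ^ 2)]
  ring

theorem integral_maternKernel_right (a : ℝ) (hb : 0 < b) (hβ : 0 < β) (hu : 0 < u) :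
    ∫ s in Ioi 0, maternKernel a b β u s = Real.Gamma b * (u ^ (2 * a + 1) * matern b β u) := by
  simp only [maternKernel]
  rw [integral_const_mul, ← Gamma_mul_matern hb hβ hu, mul_left_comm]

theorem integral_abs_maternKernel_left (ha : -1 < a) (b : ℝ) (hβ : 0 < β) (hs : 0 < s) :
    ∫ u in Ioi 0, |maternKernel a b β u s|
      = (4 * β ^ 2) ^ (a + 1) * Real.Gamma (a + 1) / 2 * (s ^ (a + b) * Real.exp (-s)) := by
  have habs : EqOn (fun u => |maternKernel a b β u s|) (fun u => s ^ (b - 1) * Real.exp (-s) *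
      (u ^ (2 * a + 1) * Real.exp (-(u ^ 2 / (4 * (β ^ 2 * s)))))) (Ioi 0) := fun u hu => by
    have hu : 0 < u := hu
    simp only [maternKernel_eq_mul_gaussian]
    exact abs_of_pos (by positivity)
  rw [setIntegral_congr_fun measurableSet_Ioi habs, integral_const_mul,
    integral_rpow_mul_gaussian (by linarith) (by positivity),
    show (2 * a + 1 + 1) / 2 = a + 1 by ring, ← mul_assoc, Real.mul_rpow (by positivity) hs.le,
    show a + b = b - 1 + (a + 1) by ring, Real.rpow_add hs (b - 1)]
  ring

theorem integrable_maternKernel (ha : -1 < a) (hb : 0 < b) (hβ : 0 < β) :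
    Integrable (Function.uncurry (maternKernel a b β))
      ((volume.restrict (Ioi 0)).prod (volume.restrict (Ioi 0))) := by
  have hmeas : Measurable (Function.uncurry (maternKernel a b β)) := by
    unfold maternKernel maternIntegrand Function.uncurry
    fun_prop
  rw [integrable_prod_iff' hmeas.aestronglyMeasurable]
  refine ⟨ae_restrict_of_forall_mem measurableSet_Ioi fun s hs => ?_, ?_⟩
  · have hs : 0 < s := hs
    simp only [Function.uncurry, maternKernel_eq_mul_gaussian]
    exact (integrableOn_rpow_mul_gaussian (by linarith) (by positivity)).const_mul _
  · have hint : IntegrableOn (fun s => s ^ (a + b) * Real.exp (-s)) (Ioi 0) := by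
      simpa only [add_sub_cancel_right] using
        integrableOn_rpow_mul_exp_neg (show 0 < a + b + 1 by linarith)
    exact (integrableOn_congr_fun (fun s hs => integral_abs_maternKernel_left ha b hβ hs)
      measurableSet_Ioi).2 (hint.const_mul _)

theorem integrableOn_rpow_mul_matern (ha : -1 < a) (hb : 0 < b) (hβ : 0 < β) :
    IntegrableOn (fun u => u ^ (2 * a + 1) * matern b β u) (Ioi 0) :=
  (integrable_const_mul_iff (Real.Gamma_pos_of_pos hb).ne'.isUnit _).1
    ((integrableOn_congr_fun (fun _ hu => integral_maternKernel_right a hb hβ hu)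
      measurableSet_Ioi).1 (integrable_maternKernel ha hb hβ).integral_prod_left)

theorem integral_besselEntire_mul_maternKernel (ha : -1 < a) (b : ℝ) (hβ : 0 < β) (hs : 0 < s)
    (z : ℝ) :
    ∫ u in Ioi 0, besselEntire a (u * z) * maternKernel a b β u s
      = (4 * β ^ 2) ^ (a + 1) / 2 *
          (s ^ (a + b + 1 - 1) * Real.exp (-((1 + β ^ 2 * z ^ 2) * s))) := by
  calc ∫ u in Ioi 0, besselEntire a (u * z) * maternKernel a b β u s
      = s ^ (b - 1) * Real.exp (-s) *
          hankel a (fun u => Real.exp (-(u ^ 2 / (4 * (β ^ 2 * s))))) z := by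
        rw [hankel, ← integral_const_mul]
        simp only [maternKernel_eq_mul_gaussian, mul_left_comm (besselEntire _ _)]
    _ = (4 * β ^ 2) ^ (a + 1) / 2 *
          (s ^ (a + b + 1 - 1) * Real.exp (-((1 + β ^ 2 * z ^ 2) * s))) := by
        rw [hankel_gaussian ha (by positivity), ← mul_assoc 4, Real.mul_rpow (by positivity) hs.le,
          show a + b + 1 - 1 = b - 1 + (a + 1) by ring, Real.rpow_add hs (b - 1),
          show -((1 + β ^ 2 * z ^ 2) * s) = -s + -(z ^ 2 * (β ^ 2 * s)) by ring, Real.exp_add]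
        ring

theorem hankel_matern (ha : -(1 / 2) ≤ a) (hb : 0 < b) (hβ : 0 < β) (z : ℝ) :
    hankel a (matern b β) z
      = (4 * β ^ 2) ^ (a + 1) / 2 * (Real.Gamma (a + b + 1) / Real.Gamma b) /
          (1 + β ^ 2 * z ^ 2) ^ (a + b + 1) := by
  have ha' : -1 < a := by linarith
  have hbessel : Measurable fun p : ℝ × ℝ => besselEntire a (p.1 * z) :=
    (measurable_besselEntire ha').comp (measurable_fst.mul_const z)
  have hprod : Integrable
      (Function.uncurry fun u s => besselEntire a (u * z) * maternKernel a b β u s)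
      ((volume.restrict (Ioi 0)).prod (volume.restrict (Ioi 0))) :=
    (integrable_maternKernel ha' hb hβ).bdd_mul hbessel.aestronglyMeasurable
      (ae_of_all _ fun p => abs_besselEntire_le ha _)
  have hswap : Real.Gamma b * hankel a (matern b β) z
      = (4 * β ^ 2) ^ (a + 1) / 2 *
          ((1 / (1 + β ^ 2 * z ^ 2)) ^ (a + b + 1) * Real.Gamma (a + b + 1)) := by
    calc Real.Gamma b * hankel a (matern b β) z
        = ∫ u in Ioi 0, ∫ s in Ioi 0, besselEntire a (u * z) * maternKernel a b β u s := by
          rw [hankel, ← integral_const_mul]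
          refine setIntegral_congr_fun measurableSet_Ioi fun u hu => ?_
          simp only [integral_const_mul, integral_maternKernel_right a hb hβ hu]
          ring
      _ = ∫ s in Ioi 0, ∫ u in Ioi 0, besselEntire a (u * z) * maternKernel a b β u s :=
          integral_integral_swap hprod
      _ = (4 * β ^ 2) ^ (a + 1) / 2 *
            ((1 / (1 + β ^ 2 * z ^ 2)) ^ (a + b + 1) * Real.Gamma (a + b + 1)) := by
          rw [setIntegral_congr_fun measurableSet_Ioi fun s hs =>
              integral_besselEntire_mul_maternKernel ha' b hβ hs z, integral_const_mul,
            Real.integral_rpow_mul_exp_neg_mul_Ioi (by linarith) (by positivity)]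
  rw [one_div, Real.inv_rpow (by positivity)] at hswap
  field_simp at hswap ⊢
  linear_combination hswap

theorem spectralDensity_matern (hd : 1 ≤ d) (hb : 0 < b) (hβ : 0 < β) (hz : 0 < z) :
    spectralDensity d (matern b β) z = maternDensity d b β z := by
  have hβpow : (4 * β ^ 2) ^ ((d : ℝ) / 2) = 2 ^ (d : ℝ) * β ^ d := by
    rw [show 4 * β ^ 2 = (2 * β) ^ 2 by ring, ← Real.rpow_natCast_mul (by positivity),
      show ((2 : ℕ) : ℝ) * (d / 2) = d by push_cast; ring, Real.mul_rpow zero_le_two hβ.le,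
      Real.rpow_natCast β]
  rw [spectralDensity_eq_hankel d _ hz, two_rpow_div_two_mul_pi_rpow,
    hankel_matern (neg_half_le_half_sub_one hd) hb hβ, maternDensity, sub_add_cancel, hβpow,
    show (d : ℝ) / 2 - 1 + b + 1 = b + d / 2 by ring, Real.rpow_neg zero_le_two, neg_div,
    Real.rpow_neg Real.pi_pos.le]
  field_simp

end Matern

section Limit

variable {a p β δ μ ν w : ℝ} {d : ℕ}

theorem tendstoUniformly_hankel {ι : Type*} {l : Filter ι} {F : ι → ℝ → ℝ} {f : ℝ → ℝ}
    (ha : -(1 / 2) ≤ a)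
    (hF : ∀ᶠ i in l, IntegrableOn (fun u => u ^ (2 * a + 1) * F i u) (Ioi 0))
    (hf : IntegrableOn (fun u => u ^ (2 * a + 1) * f u) (Ioi 0))
    (hlim : Tendsto (fun i => ∫ u in Ioi 0, |u ^ (2 * a + 1) * (F i u - f u)|) l (𝓝 0)) :
    TendstoUniformly (fun i => hankel a (F i)) (hankel a f) l := by
  have hbound := hlim.const_mul (1 / Real.Gamma (a + 1))
  rw [mul_zero] at hbound
  refine Metric.tendstoUniformly_iff.2 fun ε hε => ?_
  filter_upwards [hF, hbound.eventually_lt_const hε] with i hFi hi z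
  have hsub : IntegrableOn (fun u => u ^ (2 * a + 1) * (F i - f) u) (Ioi 0) := by
    simp only [Pi.sub_apply, mul_sub]
    exact hFi.sub hf
  rw [dist_comm, Real.dist_eq, ← hankel_sub ha hFi hf]
  exact (abs_hankel_le (abs_besselEntire_le ha) hsub z).trans_lt hi

theorem askey_le_exp (hμ : 0 ≤ μ) (δ w : ℝ) : askey δ μ w ≤ Real.exp (-(w / δ * μ)) := by
  have hbase : max 0 (1 - w / δ) ≤ Real.exp (-(w / δ)) :=
    max_le (Real.exp_pos _).le (Real.one_sub_le_exp_neg _)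
  refine (Real.rpow_le_rpow (le_max_left _ _) hbase hμ).trans_eq ?_
  rw [← Real.exp_mul, neg_mul]

theorem askey_le_exp_of_le_mul (hδ : 0 < δ) (hβ : 0 < β) (hμ : 0 ≤ μ) (hδβ : δ ≤ β * μ)
    (hw : 0 ≤ w) : askey δ μ w ≤ Real.exp (-(w / β)) := by
  refine (askey_le_exp hμ δ w).trans (Real.exp_le_exp.2 (neg_le_neg ?_))
  rw [div_mul_eq_mul_div, div_le_div_iff₀ hβ hδ, mul_assoc, mul_comm μ]
  exact mul_le_mul_of_nonneg_left hδβ hw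

theorem tendsto_askey {δ : ℝ → ℝ} (hβ : 0 < β) (hδ : Tendsto (fun μ => δ μ / μ) atTop (𝓝 β))
    (w : ℝ) : Tendsto (fun μ => askey (δ μ) μ w) atTop (𝓝 (Real.exp (-(w / β)))) := by
  have hδtop : Tendsto δ atTop atTop :=
    (hδ.pos_mul_atTop hβ tendsto_id).congr' <| by
      filter_upwards [eventually_ne_atTop 0] with μ hμ using div_mul_cancel₀ _ hμ
  have hexponent : Tendsto (fun μ => μ * -(w / δ μ)) atTop (𝓝 (-(w / β))) := by
    refine (((hδ.inv₀ hβ.ne').const_mul w).neg).congr fun μ => ?_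
    rw [inv_div]
    ring
  refine (Real.tendsto_one_add_rpow_exp_of_tendsto hexponent).congr' ?_
  filter_upwards [hδtop.eventually_ge_atTop w, hδtop.eventually_gt_atTop 0] with μ hw hpos
  rw [askey_of_le hpos hw, sub_eq_add_neg]

theorem integrableOn_rpow_mul_exp_neg_div (hp : -1 < p) (hβ : 0 < β) :
    IntegrableOn (fun w => w ^ p * Real.exp (-(w / β))) (Ioi 0) := by
  have h := integrableOn_rpow_mul_exp_neg_mul_rpow hp one_pos (inv_pos.2 hβ)
  simpa only [Real.rpow_one, neg_mul, div_eq_inv_mul] using h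

theorem tendsto_integral_abs_askey_sub_exp {δ c : ℝ → ℝ} {c₀ : ℝ} (hp : -1 < p) (hβ : 0 < β)
    (hδ : Tendsto (fun μ => δ μ / μ) atTop (𝓝 β)) (hc : Tendsto c atTop (𝓝 c₀)) :
    Tendsto (fun μ => ∫ w in Ioi 0,
      |w ^ p * (c μ * askey (δ μ) μ w - c₀ * Real.exp (-(w / β)))|) atTop (𝓝 0) := by
  rw [show 𝓝 (0 : ℝ) = 𝓝 (∫ _ in Ioi (0 : ℝ), 0) by rw [integral_zero]]
  refine tendsto_integral_filter_of_dominated_convergence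
    (fun w => (|c₀| + 1) * (w ^ p * Real.exp (-(w / (2 * β)))) +
      |c₀| * (w ^ p * Real.exp (-(w / β))))
    (Eventually.of_forall fun μ => ?_) ?_
    (((integrableOn_rpow_mul_exp_neg_div hp (mul_pos two_pos hβ)).const_mul _).add
      ((integrableOn_rpow_mul_exp_neg_div hp hβ).const_mul _)) (ae_of_all _ fun w => ?_)
  · have hmeas := measurable_askey (δ μ) μ
    exact Measurable.aestronglyMeasurable (by fun_prop)
  · filter_upwards [eventually_gt_atTop 0, hδ.eventually_lt_const (lt_two_mul_self hβ),
      hδ.eventually_const_lt hβ, hc.abs.eventually_lt_const (lt_add_one |c₀|)]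
      with μ hμ hδle hδpos hcle
    refine ae_restrict_of_forall_mem measurableSet_Ioi fun w hw => ?_
    have hw : 0 < w := hw
    have haskey : askey (δ μ) μ w ≤ Real.exp (-(w / (2 * β))) :=
      askey_le_exp_of_le_mul ((div_pos_iff_of_pos_right hμ).1 hδpos) (mul_pos two_pos hβ) hμ.le
        ((div_lt_iff₀ hμ).1 hδle).le hw.le
    have hmain : |c μ * askey (δ μ) μ w| ≤ (|c₀| + 1) * Real.exp (-(w / (2 * β))) := by
      rw [abs_mul, abs_of_nonneg (askey_nonneg _ _ _)]
      exact mul_le_mul hcle.le haskey (askey_nonneg _ _ _) (by positivity)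
    have hexp : |c₀ * Real.exp (-(w / β))| = |c₀| * Real.exp (-(w / β)) := by
      rw [abs_mul, Real.abs_exp]
    rw [Real.norm_eq_abs, abs_abs, abs_mul, abs_of_nonneg (Real.rpow_nonneg hw.le p),
      mul_left_comm, mul_left_comm |c₀|, ← mul_add, ← hexp]
    exact mul_le_mul_of_nonneg_left ((abs_sub _ _).trans (by gcongr)) (Real.rpow_nonneg hw.le p)
  · have h := (((hc.mul (tendsto_askey hβ hδ w)).sub_const
      (c₀ * Real.exp (-(w / β)))).const_mul (w ^ p)).abs
    rwa [sub_self, mul_zero, abs_zero] at h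

theorem tendsto_rpow_mul_beta (hp : 0 < p) :
    Tendsto (fun μ => μ ^ p * ProbabilityTheory.beta p (μ + 1)) atTop (𝓝 (Real.Gamma p)) := by
  have hp' : -1 < p - 1 := by linarith
  have hδ : Tendsto (fun μ : ℝ => μ / μ) atTop (𝓝 1) :=
    tendsto_const_nhds.congr' <| by
      filter_upwards [eventually_ne_atTop 0] with μ hμ using (div_self hμ).symm
  have hL1 := tendsto_integral_abs_askey_sub_exp hp' one_pos hδ (tendsto_const_nhds (x := 1))
  have hΓ : Real.Gamma p = ∫ w in Ioi 0, w ^ (p - 1) * Real.exp (-w) := by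
    simp only [Real.Gamma_eq_integral hp, mul_comm]
  refine tendsto_iff_norm_sub_tendsto_zero.2
    (squeeze_zero' (Eventually.of_forall fun μ => norm_nonneg _) ?_ hL1)
  filter_upwards [eventually_gt_atTop 0] with μ hμ
  have hβ := integral_rpow_mul_askey hp' hμ hμ
  rw [sub_add_cancel] at hβ
  rw [← hβ, hΓ, ← integral_sub (integrableOn_rpow_mul_askey hp' hμ hμ)
    (integrableOn_rpow_mul_exp_neg hp)]
  simp only [← mul_sub, one_mul, div_one]
  exact norm_integral_le_integral_norm _

theorem tendsto_Gamma_add_div_mul_rpow (hp : 0 < p) :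
    Tendsto (fun μ => Real.Gamma (μ + p) / (Real.Gamma μ * μ ^ p)) atTop (𝓝 1) := by
  have hΓ := Real.Gamma_pos_of_pos hp
  have hratio : Tendsto (fun μ => μ / (μ + p)) atTop (𝓝 1) := by
    have h := ((tendsto_const_nhds (x := p)).div_atTop tendsto_id).const_add 1
    rw [add_zero] at h
    refine (inv_one (G := ℝ) ▸ h.inv₀ one_ne_zero).congr' ?_
    filter_upwards [eventually_ne_atTop 0] with μ hμ
    rw [id, one_add_div hμ, inv_div]
  have hlim := hratio.mul ((tendsto_rpow_mul_beta hp).inv₀ hΓ.ne' |>.mul_const (Real.Gamma p))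
  rw [inv_mul_cancel₀ hΓ.ne', one_mul] at hlim
  refine hlim.congr' ?_
  filter_upwards [eventually_gt_atTop 0] with μ hμ
  rw [ProbabilityTheory.beta, show p + (μ + 1) = μ + p + 1 by ring,
    Real.Gamma_add_one (add_pos hμ hp).ne', Real.Gamma_add_one hμ.ne']
  field_simp

theorem delta_pos (hν : 0 ≤ ν) (hμ : 0 < μ) (hβ : 0 < β) : 0 < delta ν μ β := by
  unfold delta
  positivity

theorem tendsto_delta_div (hν : 0 ≤ ν) (β : ℝ) :
    Tendsto (fun μ => delta ν μ β / μ) atTop (𝓝 β) := by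
  have hp : 0 < 1 + 2 * ν := by positivity
  have hlim := ((tendsto_Gamma_add_div_mul_rpow hp).rpow_const (p := 1 / (1 + 2 * ν))
    (Or.inl one_ne_zero)).const_mul β
  rw [Real.one_rpow, mul_one] at hlim
  refine hlim.congr' ?_
  filter_upwards [eventually_gt_atTop 0] with μ hμ
  rw [delta, ← div_div, Real.div_rpow (by positivity) (by positivity), ← Real.rpow_mul hμ.le,
    mul_one_div_cancel hp.ne', Real.rpow_one, show μ + (1 + 2 * ν) = μ + 2 * ν + 1 by ring,
    mul_div_assoc]

theorem delta_rpow (hν : 0 ≤ ν) (hμ : 0 < μ) (hβ : 0 < β) :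
    delta ν μ β ^ (2 * ν + 1)
      = β ^ (2 * ν + 1) * (Real.Gamma (μ + 2 * ν + 1) / Real.Gamma μ) := by
  rw [delta, Real.mul_rpow hβ.le (by positivity), ← Real.rpow_mul (by positivity),
    add_comm 1 (2 * ν), one_div_mul_cancel (by positivity), Real.rpow_one]

theorem wendlandCoeff_delta (hν : 0 ≤ ν) (hμ : 0 < μ) (hβ : 0 < β) :
    wendlandCoeff ν μ (delta ν μ β)
      = gammaRatio ν / 2 * β ^ (-(2 * ν)) * (delta ν μ β / μ / β) := by
  have hδ := delta_pos hν hμ hβ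
  have hpow := delta_rpow hν hμ hβ
  rw [Real.rpow_add_one hδ.ne', Real.rpow_add_one hβ.ne'] at hpow
  rw [wendlandCoeff, Real.rpow_neg hδ.le, Real.rpow_neg hβ.le, Real.Gamma_add_one hμ.ne']
  field_simp at hpow ⊢
  linear_combination -gammaRatio ν * hpow

theorem tendsto_wendlandCoeff_delta (hν : 0 ≤ ν) (hβ : 0 < β) :
    Tendsto (fun μ => wendlandCoeff ν μ (delta ν μ β)) atTop
      (𝓝 (gammaRatio ν / 2 * β ^ (-(2 * ν)))) := by
  have h := ((tendsto_delta_div hν β).div_const β).const_mul (gammaRatio ν / 2 * β ^ (-(2 * ν)))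
  rw [div_self hβ.ne', mul_one] at h
  refine h.congr' ?_
  filter_upwards [eventually_gt_atTop 0] with μ hμ using (wendlandCoeff_delta hν hμ hβ).symm

theorem gammaRatio_mul_Gamma_add_half (hν : 0 ≤ ν) :
    gammaRatio ν * Real.Gamma (ν + 1 / 2) = 2 ^ (1 - 2 * ν) * √Real.pi := by
  rcases hν.eq_or_lt with rfl | hν
  · rw [gammaRatio, if_pos rfl, zero_add, Real.Gamma_one_half_eq, mul_zero, sub_zero, Real.rpow_one]
  · rw [gammaRatio, if_neg hν.ne', div_mul_eq_mul_div, Real.Gamma_mul_Gamma_add_half]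
    field_simp

theorem hankel_matern_add_half (ha : -(1 / 2) ≤ a) (hν : 0 ≤ ν) (hβ : 0 < β) (z : ℝ) :
    hankel a (matern (ν + 1 / 2) β) z
      = gammaRatio ν / 2 * β ^ (-(2 * ν)) * hankel (a + ν) (fun r => Real.exp (-(r / β))) z := by
  have hΓ := Real.Gamma_pos_of_pos (show 0 < ν + 1 / 2 by positivity)
  have hratio := gammaRatio_mul_Gamma_add_half hν
  have hpow : (4 * β ^ 2) ^ ν = 2 ^ (2 * ν) * β ^ (2 * ν) := by
    rw [show 4 * β ^ 2 = (2 * β) ^ 2 by ring, ← Real.rpow_natCast_mul (by positivity),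
      Nat.cast_ofNat, Real.mul_rpow zero_le_two hβ.le]
  rw [← hankel_congr (fun r hr => matern_half hβ hr), hankel_matern ha (by positivity) hβ,
    hankel_matern (by linarith) one_half_pos hβ, Real.Gamma_one_half_eq,
    eq_div_of_mul_eq hΓ.ne' hratio, Real.rpow_neg hβ.le, show a + ν + 1 = a + 1 + ν by ring,
    Real.rpow_add (by positivity) (a + 1) ν, hpow, Real.rpow_sub two_pos, Real.rpow_one,
    ← add_assoc a]
  field_simp

theorem tendstoUniformly_hankel_phi (ha : -(1 / 2) ≤ a) (hν : 0 ≤ ν) (hβ : 0 < β) :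
    TendstoUniformly (fun μ => hankel a (phi ν μ β)) (hankel a (matern (ν + 1 / 2) β)) atTop := by
  have hp : -1 < 2 * (a + ν) + 1 := by linarith
  have hexp := integrableOn_rpow_mul_exp_neg_div hp hβ
  have hlim := tendstoUniformly_hankel (a := a + ν) (by linarith)
    (F := fun μ w => wendlandCoeff ν μ (delta ν μ β) * askey (delta ν μ β) μ w)
    (f := fun w => gammaRatio ν / 2 * β ^ (-(2 * ν)) * Real.exp (-(w / β)))
    (by
      filter_upwards [eventually_gt_atTop 0] with μ hμ
      simp only [mul_left_comm _ (wendlandCoeff _ _ _)]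
      exact (integrableOn_rpow_mul_askey hp (delta_pos hν hμ hβ) hμ).const_mul _)
    (by
      simp only [mul_left_comm _ (gammaRatio ν / 2 * β ^ (-(2 * ν)))]
      exact hexp.const_mul _)
    (tendsto_integral_abs_askey_sub_exp hp hβ (tendsto_delta_div hν β)
      (tendsto_wendlandCoeff_delta hν hβ))
  have hmatern : hankel a (matern (ν + 1 / 2) β) = hankel (a + ν) fun w =>
      gammaRatio ν / 2 * β ^ (-(2 * ν)) * Real.exp (-(w / β)) := by
    ext z
    rw [hankel_const_mul, hankel_matern_add_half ha hν hβ]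
  rw [hmatern]
  refine (tendstoUniformly_congr ?_).1 hlim
  filter_upwards [eventually_gt_atTop 0] with μ hμ
  ext z
  rw [hankel_const_mul]
  exact (hankel_genWendland ha hν (delta_pos hν hμ hβ) hμ z).symm

theorem tendstoUniformlyOn_spectralDensity_phi (hd : 1 ≤ d) (hν : 0 ≤ ν) (hβ : 0 < β) :
    TendstoUniformlyOn (fun μ => spectralDensity d (phi ν μ β))
      (spectralDensity d (matern (ν + 1 / 2) β)) atTop (Ioi 0) := by
  have h := (Real.uniformContinuous_const_mul (x := 2 ^ (1 - (d : ℝ) / 2) /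
    (2 * Real.pi) ^ ((d : ℝ) / 2))).comp_tendstoUniformly
      (tendstoUniformly_hankel_phi (neg_half_le_half_sub_one hd) hν hβ)
  exact (h.tendstoUniformlyOn.congr (Eventually.of_forall fun _ _ hz =>
    (spectralDensity_eq_hankel d _ hz).symm)).congr_right fun _ hz =>
      (spectralDensity_eq_hankel d _ hz).symm

end Limit

end Wendland

end

theorem theorem2_general (d : ℕ) (hd : 1 ≤ d) (ν β : ℝ) (hν : 0 ≤ ν) (hβ : 0 < β) :
    (∀ μ δ : ℝ, 0 < μ → 0 < δ →
      MeasureTheory.IntegrableOn (fun r : ℝ => Wendland.genWendland ν μ δ r * r ^ (d - 1))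
        (Set.Ioi 0) ∧
      ∀ z : ℝ, 0 < z → Wendland.spectralDensity d (Wendland.genWendland ν μ δ) z =
        Wendland.genWendlandDensity d ν μ δ z) ∧
    (∀ b : ℝ, 0 < b →
      MeasureTheory.IntegrableOn (fun r : ℝ => Wendland.matern b β r * r ^ (d - 1)) (Set.Ioi 0) ∧
      ∀ z : ℝ, 0 < z → Wendland.spectralDensity d (Wendland.matern b β) z =
        Wendland.maternDensity d b β z) ∧
    TendstoUniformlyOn (fun μ : ℝ => Wendland.spectralDensity d (Wendland.phi ν μ β))
      (Wendland.spectralDensity d (Wendland.matern (ν + 1 / 2) β)) Filter.atTop (Set.Ioi 0) := by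
  have ha : -1 < (d : ℝ) / 2 - 1 := by linarith [Wendland.neg_half_le_half_sub_one hd]
  exact ⟨fun μ δ hμ hδ =>
      ⟨(Wendland.integrableOn_mul_pow_iff_rpow hd).2
        (Wendland.integrableOn_rpow_mul_genWendland ha hν hδ hμ),
        fun z hz => Wendland.spectralDensity_genWendland hd hν hδ hμ hz⟩,
    fun b hb =>
      ⟨(Wendland.integrableOn_mul_pow_iff_rpow hd).2
        (Wendland.integrableOn_rpow_mul_matern ha hb hβ),
        fun z hz => Wendland.spectralDensity_matern hd hb hβ hz⟩,
    Wendland.tendstoUniformlyOn_spectralDensity_phi hd hν hβ⟩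

theorem theorem2 (d : ℕ) (hd : 1 ≤ d) (ν β : ℝ) (hν : 0 ≤ ν) (hβ : 0 < β) :
    -- the spectral density of `φ_{ν,μ,β}` is well defined and given by the `₁F₂` expression
    (∀ μ : ℝ, 0 < μ →
      MeasureTheory.IntegrableOn (fun r : ℝ => Wendland.phi ν μ β r * r ^ (d - 1)) (Set.Ioi 0) ∧
      ∀ z : ℝ, 0 < z →
        Wendland.spectralDensity d (Wendland.phi ν μ β) z =
          Wendland.genWendlandDensity d ν μ (Wendland.delta ν μ β) z) ∧
    -- the spectral density of `M_{ν+1/2,β}` is well defined and given by its closed form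
    (MeasureTheory.IntegrableOn
        (fun r : ℝ => Wendland.matern (ν + 1 / 2) β r * r ^ (d - 1)) (Set.Ioi 0) ∧
      ∀ z : ℝ, 0 < z →
        Wendland.spectralDensity d (Wendland.matern (ν + 1 / 2) β) z =
          Wendland.maternDensity d (ν + 1 / 2) β z) ∧
    -- uniform convergence on every bounded subinterval of the positive real line
    (∀ I : Set ℝ, I.OrdConnected → Bornology.IsBounded I → I ⊆ Set.Ioi 0 →
      TendstoUniformlyOn (fun μ : ℝ => Wendland.spectralDensity d (Wendland.phi ν μ β))
        (Wendland.spectralDensity d (Wendland.matern (ν + 1 / 2) β)) Filter.atTop I) := by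
  obtain ⟨hwendland, hmatern, hlim⟩ := theorem2_general d hd ν β hν hβ
  exact ⟨fun μ hμ => hwendland μ _ hμ (Wendland.delta_pos hν hμ hβ),
    hmatern _ (by positivity), fun _ _ _ hI => hlim.mono hI⟩
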